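/- Cohomology means singular cohomology, with coefficients in an arbitrary module over an arbitrary commutative ring. A space has the cohomology of a $d$-dimensional sphere ($d\ge -1$) if in every degree and for all coefficients its cohomology module is isomorphic to that of the unit sphere $S^{d}\subset\mathbb{R}^{d+1}$, where $S^{-1}=\emptyset$. (1) Let $X$ be a finite simplicial complex covered by a finite family $(X_i)_{i\in I}$, $|I|\ge 1$, of subcomplexes. Suppose that $\bigcap_{j\in I'}X_j$ is contractible (in particular nonempty) for every nonempty proper subset $I'\subsetneq I$, and that $\bigcap_{i\in I}X_i=\emptyset$. Then $X$ has the cohomology of an $(|I|-2)$-dimensional sphere. (2) Let $(W,S)$ be a Coxeter system with $S$ finite. For $J\subseteq S$ write $W_J=\langle J\rangle$. Let $\Delta$ be the simplex of dimension $|S|-1$ whose codimension $1$ faces $\Delta_s$ are indexed by $s\in S$. For a nonempty face $\sigma$ of $\Delta$ let $W_\sigma$ be the subgroup generated by the $s\in S$ with $\sigma\subseteq\Delta_s$. The Davis chamber $D$ is the full subcomplex of the barycentric subdivision of $\Delta$ spanned by the barycenters of the nonempty faces $\sigma$ with $W_\sigma$ finite. Put $D_s=D\cap\Delta_s$, and for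 $J\subseteq S$ consider the conditions (a) $W_J$ is infinite, but $W_{J'}$ is finite for every $J'\subsetneq J$; (b) $\bigcap_{s\in J'}D_s\neq\emptyset$ for every nonempty $J'\subsetneq J$, but $\bigcap_{s\in J}D_s=\emptyset$ (the intersection over $J=\emptyset$ being the whole ambient space). If $W$ is infinite, then (a) and (b) are equivalent. If $J$ is nonempty and (a) or (b) holds, then $\bigcup_{s\in J}D_s$ has the cohomology of a $(|J|-2)$-dimensional sphere. Condition (a) forces $|J|\ge 2$. -/

import Mathlib

open CategoryTheory

universe u v w

noncomputable section

/-! ### Simplicial complexes and their realizations -/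

/-- The geometric realization of a (finite) abstract simplicial complex on a finite vertex type `V`:
the points of the standard simplex of `V` whose support is a face, with the subspace topology. -/
def geomRealization {V : Type u} [Fintype V] (K : PreAbstractSimplicialComplex V) :
    Set (V → ℝ) :=
  {x | x ∈ stdSimplex ℝ V ∧ ∃ t ∈ K.faces, ∀ a, a ∈ t ↔ x a ≠ 0}

/-- The first barycentric subdivision: the vertices are the faces of `K` (standing for their
barycenters), the simplices are the nonempty finite chains of faces. -/
def barycentricSubdivision {V : Type u} (K : PreAbstractSimplicialComplex V) :
    PreAbstractSimplicialComplex (Finset V) where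
  faces := {t | t.Nonempty ∧ (∀ σ ∈ t, σ ∈ K.faces) ∧
    IsChain (fun σ τ : Finset V => σ ⊆ τ) (t : Set (Finset V))}
  isRelLowerSet_faces := by
    intro t ht
    refine ⟨ht.1, fun t' ht' hne => ⟨hne, fun σ hσ => ht.2.1 σ (ht' hσ), ?_⟩⟩
    exact ht.2.2.mono (Finset.coe_subset.mpr ht')

/-! ### Singular cohomology -/

/-- Singular cohomology `H^k(X; M)`: the cohomology of the cochain complex
`Hom_R(C_•(X; R), M)`, where `C_•(X; R)` is the singular chain complex of `X`. -/
def singularCohomology {R : Type u} [CommRing R] (X : Type u) [TopologicalSpace X]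
    (M : ModuleCat.{u} R) (k : ℕ) : ModuleCat.{u} R :=
  ((((AlgebraicTopology.singularChainComplexFunctor (ModuleCat.{u} R)).obj
    (ModuleCat.of R R)).obj (TopCat.of X)).linearYonedaObj R M).homology k

/-- `X` has the cohomology of the unit sphere of `ℝⁿ`, that is, of the sphere of dimension `n - 1`
(the empty space if `n = 0`): the singular cohomology modules are isomorphic in all degrees,
for all coefficient modules. -/
def HasCohomologyOfUnitSphere (X : Type u) [TopologicalSpace X] (n : ℕ) : Prop :=
  ∀ (R : Type u) [CommRing R] (M : ModuleCat.{u} R) (k : ℕ),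
    Nonempty (singularCohomology X M k ≅
      singularCohomology (ULift.{u} (Metric.sphere (0 : EuclideanSpace ℝ (Fin n)) 1)) M k)

/-! ### The Davis chamber

`Δ` is the full simplex `⊤` with vertex set `B`, the index set of the generators. The vertex of `Δ`
indexed by `s` is the one opposite to the codimension 1 face `Δ_s`. -/

/-- The codimension 1 face `Δ_s` of `Δ`, as a subcomplex. -/
def simplexFacet {B : Type u} (s : B) : PreAbstractSimplicialComplex B where
  faces := {σ | σ.Nonempty ∧ s ∉ σ}
  isRelLowerSet_faces := by
    intro σ hσ
    exact ⟨hσ.1, fun τ hτ hne => ⟨hne, fun h => hσ.2 (hτ h)⟩⟩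

section Davis

variable {B : Type u} {M : CoxeterMatrix B} {W : Type v} [Group W]

/-- The (standard) parabolic subgroup `W_J = ⟨J⟩`. -/
def parabolicSubgroup (cs : CoxeterSystem M W) (J : Set B) : Subgroup W :=
  Subgroup.closure (cs.simple '' J)

/-- The parabolic subgroup `W_σ` of a face `σ` of `Δ`: it is generated by the `s` such that `σ` is
contained in `Δ_s`. -/
def faceParabolic (cs : CoxeterSystem M W) (σ : Finset B) : Subgroup W :=
  parabolicSubgroup cs {s | σ ∈ (simplexFacet s).faces}

/-- The Davis chamber `D`: the full subcomplex of the barycentric subdivision of `Δ` spanned by the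
barycenters of the faces `σ` with `W_σ` finite. -/
def davisChamber (cs : CoxeterSystem M W) : PreAbstractSimplicialComplex (Finset B) where
  faces := {t | t ∈ (barycentricSubdivision (⊤ : PreAbstractSimplicialComplex B)).faces ∧
    ∀ σ ∈ t, Finite (faceParabolic cs σ)}
  isRelLowerSet_faces := by
    intro t ht
    have h := (barycentricSubdivision (⊤ : PreAbstractSimplicialComplex B)).isRelLowerSet_faces ht.1
    exact ⟨h.1, fun t' ht' hne => ⟨h.2 ht' hne, fun σ hσ => ht.2 σ (ht' hσ)⟩⟩

/-- `D_s = D ∩ Δ_s`. -/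
def davisFacet (cs : CoxeterSystem M W) (s : B) : PreAbstractSimplicialComplex (Finset B) :=
  davisChamber cs ⊓ barycentricSubdivision (simplexFacet s)

/-- The space `⋃_{s ∈ J} D_s`. -/
def davisUnion [Fintype B] (cs : CoxeterSystem M W) (J : Finset B) : Set (Finset B → ℝ) :=
  ⋃ s ∈ J, geomRealization (davisFacet cs s)

/-- `W_J` is infinite, but all its proper parabolic subgroups are finite. -/
def IsMinimalInfinite (cs : CoxeterSystem M W) (J : Finset B) : Prop :=
  Infinite (parabolicSubgroup cs (J : Set B)) ∧
    ∀ J' : Finset B, J' ⊂ J → Finite (parabolicSubgroup cs (J' : Set B))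

/-- `⋂_{s ∈ J'} D_s` is nonempty for all nonempty `J' ⊊ J`, but `⋂_{s ∈ J} D_s` is empty. -/
def IsMinimalEmptyIntersection [Fintype B] (cs : CoxeterSystem M W) (J : Finset B) : Prop :=
  (∀ J' : Finset B, J'.Nonempty → J' ⊂ J →
    (⋂ s ∈ J', geomRealization (davisFacet cs s)).Nonempty) ∧
  ⋂ s ∈ J, geomRealization (davisFacet cs s) = ∅

end Davis

end

/-! The cohomology is never computed: `X` is shown to be homotopy equivalent to the sphere. With `n
+ 1` indices, the model is the space `N` of nonconstant functions `I → ℝ`, which is `ℝⁿ` minus the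
origin up to translation by constants, hence a sphere up to homotopy. It is covered by the closed
sets `N_i` of functions maximal at `i`, which have no common point. For `n = 0` everything is empty.

The map `x ↦ (-dist(x, X_i))_i` sends `X_i` into `N_i`. A map back sending `N_i` into `X_i` is built
cell by cell (`exists_continuousOn_carried`): each cell is assigned a contractible intersection of
the `X_i`, and maps from its boundary extend. The composite on `N` is joined to the identity by
segments, since a function and its image share a maximal index and so no constant is met. The
composite on `X` preserves each `X_i`, and the same carrier argument on prisms makes it homotopic to
the identity (`homotopic_id_of_mapsTo`).

For the Davis chamber, the intersection of the `D_s` over nonempty `J` is a cone whose apex is the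
barycenter of the face with vertex set `Jᶜ`, provided `W_J` is finite and `J` is not everything;
otherwise it is empty. This gives the equivalence of (a) and (b), and the hypotheses of the covering
theorem. -/

/-! ### Homotopy invariance of singular cohomology -/

/-- The opposite of a homotopy equivalence between complexes in an opposite category. -/
noncomputable def HomotopyEquiv.unop {V ι : Type*} [Category* V] {c : ComplexShape ι} [Preadditive V]
    {C D : HomologicalComplex Vᵒᵖ c} (e : HomotopyEquiv C D) : HomotopyEquiv D.unop C.unop where
  hom := (HomologicalComplex.unopFunctor V c).map e.hom.op
  inv := (HomologicalComplex.unopFunctor V c).map e.inv.op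
  homotopyHomInvId := e.homotopyInvHomId.unop
  homotopyInvHomId := e.homotopyHomInvId.unop

/-- The homotopy equivalence between singular chain complexes induced by a homotopy equivalence
of spaces. -/
noncomputable def ContinuousMap.HomotopyEquiv.singularChainComplex {C : Type*} [Category* C] [Preadditive C]
    [Limits.HasCoproducts.{u} C] {X Y : Type u} [TopologicalSpace X] [TopologicalSpace Y]
    (e : ContinuousMap.HomotopyEquiv X Y) (A : C) :
    _root_.HomotopyEquiv
      (((AlgebraicTopology.singularChainComplexFunctor C).obj A).obj (TopCat.of X))
      (((AlgebraicTopology.singularChainComplexFunctor C).obj A).obj (TopCat.of Y)) where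
  hom := ((AlgebraicTopology.singularChainComplexFunctor C).obj A).map (TopCat.ofHom e.toFun)
  inv := ((AlgebraicTopology.singularChainComplexFunctor C).obj A).map (TopCat.ofHom e.invFun)
  homotopyHomInvId := by
    have H : TopCat.Homotopy (TopCat.ofHom e.toFun ≫ TopCat.ofHom e.invFun)
      (𝟙 (TopCat.of X)) := Classical.choice e.left_inv
    rw [← Functor.map_comp, ← CategoryTheory.Functor.map_id]
    exact H.singularChainComplexFunctorObjMap A
  homotopyInvHomId := by
    have H : TopCat.Homotopy (TopCat.ofHom e.invFun ≫ TopCat.ofHom e.toFun)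
      (𝟙 (TopCat.of Y)) := Classical.choice e.right_inv
    rw [← Functor.map_comp, ← CategoryTheory.Functor.map_id]
    exact H.singularChainComplexFunctorObjMap A

/-- Homotopy invariance of singular cohomology. -/
theorem nonempty_singularCohomology_iso {X Y : Type u} [TopologicalSpace X] [TopologicalSpace Y]
    (e : ContinuousMap.HomotopyEquiv X Y) {R : Type u} [CommRing R] (M : ModuleCat.{u} R) (k : ℕ) :
    Nonempty (singularCohomology X M k ≅ singularCohomology Y M k) :=
  -- Passing out of the opposite category reverses the direction, hence the final `symm`.
  ⟨((((linearYoneda R (ModuleCat.{u} R)).obj M).rightOp.mapHomotopyEquiv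
    (e.singularChainComplex (ModuleCat.of R R))).unop.toHomologyIso k).symm⟩

theorem hasCohomologyOfUnitSphere_of_homotopyEquiv {X : Type u} [TopologicalSpace X] {n : ℕ}
    (e : ContinuousMap.HomotopyEquiv X (Metric.sphere (0 : EuclideanSpace ℝ (Fin n)) 1)) :
    HasCohomologyOfUnitSphere X n := fun _ _ M k =>
  nonempty_singularCohomology_iso (e.trans Homeomorph.ulift.symm.toHomotopyEquiv) M k

/-! ### Extension of maps into contractible sets, and carriers -/

open Set in
/-- A contraction of the subset `C`, as a function on the ambient space. -/
theorem exists_contraction {Z : Type*} [TopologicalSpace Z] (C : Set Z) [ContractibleSpace C] :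
    ∃ (h : ℝ × Z → Z) (z₀ : Z), z₀ ∈ C ∧ ContinuousOn h (univ ×ˢ C) ∧
      (∀ t, ∀ z ∈ C, h (t, z) ∈ C) ∧ (∀ t ≤ 0, ∀ z ∈ C, h (t, z) = z) ∧
      ∀ t ≥ 1, ∀ z ∈ C, h (t, z) = z₀ := by
  classical
  obtain ⟨z₀, ⟨H⟩⟩ := id_nullhomotopic C
  have hval : ∀ t, ∀ z (hz : z ∈ C), (if h : z ∈ C then (H (projIcc 0 1 zero_le_one t, ⟨z, h⟩) : Z)
      else z) = H (projIcc 0 1 zero_le_one t, ⟨z, hz⟩) := fun t z hz => dif_pos hz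
  refine ⟨fun p => if h : p.2 ∈ C then (H (projIcc 0 1 zero_le_one p.1, ⟨p.2, h⟩) : Z) else p.2,
    z₀, z₀.2, ?_, fun t z hz => ?_, fun t ht z hz => ?_, fun t ht z hz => ?_⟩
  · rw [continuousOn_iff_continuous_domRestrict]
    have : Continuous fun p : (univ ×ˢ C : Set (ℝ × Z)) =>
        (H (projIcc 0 1 zero_le_one p.1.1, ⟨p.1.2, p.2.2⟩) : Z) := by
      refine continuous_subtype_val.comp (H.continuous.comp (Continuous.prodMk
        (continuous_projIcc.comp (by fun_prop)) (by fun_prop)))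
    exact this.congr fun p => (hval p.1.1 p.1.2 p.2.2).symm
  · dsimp only
    rw [hval t z hz]
    exact Subtype.coe_prop _
  · dsimp only
    rw [hval t z hz, projIcc_of_le_left _ ht]
    exact congrArg Subtype.val (H.apply_zero ⟨z, hz⟩)
  · dsimp only
    rw [hval t z hz, projIcc_of_right_le _ ht]
    exact congrArg Subtype.val (H.apply_one ⟨z, hz⟩)

open Set in
/-- A map from a neighbourhood retract `b` of `e` to a contractible subset `C` extends to `e`. -/
theorem exists_extension_of_contractible {Y Z : Type*} [TopologicalSpace Y] [TopologicalSpace Z]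
    {C : Set Z} [ContractibleSpace C] {e b : Set Y} {u : Y → ℝ} {r : Y → Y}
    (hu : ContinuousOn u e) (hub : ∀ y ∈ b, u y = 0) (hr : ContinuousOn r {y ∈ e | u y < 1})
    (hrb : ∀ y ∈ e, u y < 1 → r y ∈ b) (hrid : ∀ y ∈ b, r y = y)
    {φ : Y → Z} (hφ : ContinuousOn φ b) (hφC : MapsTo φ b C) :
    ∃ ψ : Y → Z, ContinuousOn ψ e ∧ EqOn ψ φ b ∧ MapsTo ψ e C := by
  classical
  obtain ⟨h, z₀, hz₀, hc, hC, h0, h1⟩ := exists_contraction C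
  -- The extension follows `φ ∘ r` along the contraction at time `2 * u`. It is already constant for
  -- `u > 1/2`, so the behaviour of `r` where `u ≥ 1` is irrelevant.
  have key : ∀ y ∈ e, 1 / 2 < u y →
      (if u y < 1 then h (2 * u y, φ (r y)) else z₀) = z₀ := by
    intro y hy hlt
    split_ifs with hy1
    · exact h1 _ (by linarith) _ (hφC (hrb y hy hy1))
    · rfl
  refine ⟨fun y => if u y < 1 then h (2 * u y, φ (r y)) else z₀, ?_, ?_, ?_⟩
  · intro y hy
    rcases lt_or_ge (u y) 1 with hlt | hge
    · have hcont : ContinuousOn (fun y => h (2 * u y, φ (r y))) {y ∈ e | u y < 1} := by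
        refine hc.comp (ContinuousOn.prodMk ?_ ?_) fun y hy => ⟨trivial, hφC (hrb y hy.1 hy.2)⟩
        · exact continuousOn_const.mul (hu.mono fun y hy => hy.1)
        · exact hφ.comp hr fun y hy => hrb y hy.1 hy.2
      have hmem : {y ∈ e | u y < 1} ∈ nhdsWithin y e :=
        Filter.inter_mem self_mem_nhdsWithin ((hu y hy).eventually_lt_const hlt)
      have h2 := (hcont y ⟨hy, hlt⟩).mono_of_mem_nhdsWithin hmem
      refine h2.congr_of_eventuallyEq ?_ (if_pos hlt)
      filter_upwards [hmem] with y' hy'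
      exact if_pos hy'.2
    · refine (continuousWithinAt_const (b := z₀)).congr_of_eventuallyEq ?_
        (key y hy (by linarith))
      filter_upwards [self_mem_nhdsWithin,
        (hu y hy).eventually_const_lt (show (1 / 2 : ℝ) < u y by linarith)] with y' hy' hlt
      exact key y' hy' hlt
  · intro y hy
    simp only [hub y hy, hrid y hy, zero_lt_one, if_true]
    exact h0 _ (by simp) _ (hφC hy)
  · intro y hy
    dsimp only
    split_ifs with hlt
    · exact hC _ _ (hφC (hrb y hy hlt))
    · exact hz₀

open Set in
/-- The method of carriers: a map on a closed set `A` carried by `C` extends over the cells `e j`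
to a map that is carried by `C`, if it does so over each cell. -/
theorem exists_continuousOn_carried {Y Z J : Type*} [TopologicalSpace Y] [TopologicalSpace Z]
    [Finite J] [PartialOrder J] {e : J → Set Y} {A : Set Y} {C : J → Set Z} {g₀ : Y → Z}
    (he : ∀ j, IsClosed (e j)) (hA : IsClosed A) (hC : Monotone C)
    (hinter : ∀ j l, ∀ y ∈ e j, y ∈ e l → ∃ m ≤ j, m ≤ l ∧ y ∈ e m)
    (hext : ∀ j, ∀ φ : Y → Z, ContinuousOn φ (e j ∩ (A ∪ ⋃ l < j, e l)) →
      MapsTo φ (e j ∩ (A ∪ ⋃ l < j, e l)) (C j) →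
      ∃ ψ : Y → Z, ContinuousOn ψ (e j) ∧ EqOn ψ φ (e j ∩ (A ∪ ⋃ l < j, e l)) ∧
        MapsTo ψ (e j) (C j))
    (hg₀ : ContinuousOn g₀ A) (hg₀C : ∀ j, MapsTo g₀ (A ∩ e j) (C j)) :
    ∃ g : Y → Z, ContinuousOn g (A ∪ ⋃ j, e j) ∧ EqOn g g₀ A ∧ ∀ j, MapsTo g (e j) (C j) := by
  classical
  have main : ∀ S : Finset J, IsLowerSet (S : Set J) →
      ∃ g : Y → Z, ContinuousOn g (A ∪ ⋃ j ∈ S, e j) ∧ EqOn g g₀ A ∧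
        ∀ j ∈ S, MapsTo g (e j) (C j) := by
    intro S
    induction S using Finset.strongInduction with
    | H S ih =>
    intro hS
    rcases S.eq_empty_or_nonempty with rfl | hne
    · exact ⟨g₀, by simpa using hg₀, fun _ _ => rfl, by simp⟩
    -- Cells are attached in an order refining the partial order: the last one is maximal in `S`.
    obtain ⟨j, hj⟩ := S.exists_maximal hne
    have hlow : IsLowerSet ((S.erase j : Finset J) : Set J) := by
      intro a b hba ha
      simp only [Finset.coe_erase, mem_sdiff, Finset.mem_coe, mem_singleton_iff] at ha ⊢
      refine ⟨hS hba ha.1, ?_⟩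
      rintro rfl
      exact ha.2 (le_antisymm (hj.2 ha.1 hba) hba)
    obtain ⟨g, hg, hgA, hgC⟩ := ih _ (Finset.erase_ssubset hj.1) hlow
    have hsub : e j ∩ (A ∪ ⋃ l < j, e l) ⊆ A ∪ ⋃ l ∈ S.erase j, e l := by
      rintro y ⟨-, hy | hy⟩
      · exact Or.inl hy
      · simp only [mem_iUnion] at hy
        obtain ⟨l, hl, hy⟩ := hy
        exact Or.inr (mem_biUnion (Finset.mem_coe.2
          (Finset.mem_erase.2 ⟨hl.ne, hS hl.le hj.1⟩)) hy)
    -- By `hinter`, the new cell meets the earlier ones only in cells strictly below it, so `ψ` and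
    -- `g` agree on the whole overlap.
    have hsup : ∀ y ∈ e j, y ∈ (A ∪ ⋃ l ∈ S.erase j, e l) →
        y ∈ e j ∩ (A ∪ ⋃ l < j, e l) := by
      rintro y hyj (hy | hy)
      · exact ⟨hyj, Or.inl hy⟩
      · simp only [mem_iUnion] at hy
        obtain ⟨l, hl, hy⟩ := hy
        obtain ⟨m, hmj, hml, hym⟩ := hinter j l y hyj hy
        have hl' := Finset.mem_erase.1 hl
        have : m ≠ j := by
          rintro rfl
          exact hl'.1 (le_antisymm (hj.2 hl'.2 hml) hml)
        exact ⟨hyj, Or.inr (mem_biUnion (lt_of_le_of_ne hmj this : m < j) hym)⟩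
    obtain ⟨ψ, hψ, hψg, hψC⟩ := hext j g (hg.mono hsub) (by
      rintro y ⟨hyj, hy | hy⟩
      · rw [hgA hy]; exact hg₀C j ⟨hy, hyj⟩
      · simp only [mem_iUnion] at hy
        obtain ⟨l, hl, hy⟩ := hy
        exact hC hl.le (hgC l (Finset.mem_erase.2 ⟨hl.ne, hS hl.le hj.1⟩) hy))
    have hEq : EqOn (fun y => if y ∈ e j then ψ y else g y) g (A ∪ ⋃ l ∈ S.erase j, e l) := by
      intro y hy
      by_cases hyj : y ∈ e j
      · simpa [hyj] using hψg (hsup y hyj hy)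
      · simp [hyj]
    have hEq' : EqOn (fun y => if y ∈ e j then ψ y else g y) ψ (e j) := fun y hy => if_pos hy
    refine ⟨fun y => if y ∈ e j then ψ y else g y, ?_, fun y hy => ?_, fun l hl => ?_⟩
    · have hun : (A ∪ ⋃ l ∈ S, e l) = (A ∪ ⋃ l ∈ S.erase j, e l) ∪ e j := by
        conv_lhs => rw [← Finset.insert_erase hj.1, Finset.set_biUnion_insert]
        rw [union_comm (e j), union_assoc]
      rw [hun]
      refine ContinuousOn.union_of_isClosed (hg.congr hEq) (hψ.congr hEq') ?_ (he j)
      exact hA.union (isClosed_biUnion_finset fun l _ => he l)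
    · rw [hEq (Or.inl hy), hgA hy]
    · by_cases hlj : l = j
      · subst hlj
        exact hψC.congr hEq'.symm
      · have hl' : l ∈ S.erase j := Finset.mem_erase.2 ⟨hlj, hl⟩
        exact (hgC l hl').congr (hEq.mono fun y hy => Or.inr (mem_biUnion hl' hy)).symm
  have := Fintype.ofFinite J
  obtain ⟨g, hg, hgA, hgC⟩ := main Finset.univ (by simpa using isLowerSet_univ)
  exact ⟨g, by simpa using hg, hgA, fun j => hgC j (Finset.mem_univ j)⟩

/-! ### The model of the sphere: nonconstant functions -/

/-- The nonconstant real functions on `I`. -/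
def nonconstantFunctions (I : Type*) : Set (I → ℝ) := {y | ∃ i j, y i ≠ y j}

theorem continuous_nonconstantFunctions_apply {I : Type*} (i : I) :
    Continuous fun y : nonconstantFunctions I => y.1 i :=
  (continuous_apply i).comp continuous_subtype_val

/-- Two nonconstant functions which attain their maximum at a common point are joined by a segment
of nonconstant functions. -/
theorem nonconstantFunctions_segment {I : Type*} {y z : I → ℝ} (hy : y ∈ nonconstantFunctions I)
    (hz : z ∈ nonconstantFunctions I) {i : I} (hyi : ∀ j, y j ≤ y i) (hzi : ∀ j, z j ≤ z i)
    {t : ℝ} (h0 : 0 ≤ t) (h1 : t ≤ 1) :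
    (fun j => (1 - t) * y j + t * z j) ∈ nonconstantFunctions I := by
  have key : ∀ w ∈ nonconstantFunctions I, (∀ j, w j ≤ w i) → ∃ j, w j < w i := by
    rintro w ⟨a, b, hab⟩ hw
    by_contra! h
    exact hab (((hw a).antisymm (h a)).trans ((hw b).antisymm (h b)).symm)
  rcases h1.lt_or_eq with h1 | rfl
  · obtain ⟨j, hj⟩ := key y hy hyi
    refine ⟨j, i, ne_of_lt ?_⟩
    have := hzi j
    have h2 : (1 - t) * y j < (1 - t) * y i := mul_lt_mul_of_pos_left hj (by linarith)
    have h3 : t * z j ≤ t * z i := mul_le_mul_of_nonneg_left this h0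
    linarith
  · simpa using hz

/-- The nonconstant functions on a set with `n + 1` elements have the homotopy type of the unit
sphere of `ℝⁿ`. -/
theorem nonempty_homotopyEquiv_nonconstantFunctions_sphere {I : Type*} [Fintype I] {n : ℕ}
    (hI : Fintype.card I = n + 1) :
    Nonempty (ContinuousMap.HomotopyEquiv (nonconstantFunctions I)
      (Metric.sphere (0 : EuclideanSpace ℝ (Fin n)) 1)) := by
  let e : I ≃ Fin (n + 1) := Fintype.equivFinOfCardEq hI
  -- The linear map `d` vanishes exactly on constants, and `c` is a section of it.
  let d : (I → ℝ) → EuclideanSpace ℝ (Fin n) := fun y =>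
    WithLp.toLp 2 fun k => y (e.symm k.succ) - y (e.symm 0)
  let c : EuclideanSpace ℝ (Fin n) → I → ℝ := fun s i => Fin.cons (α := fun _ => ℝ) 0 s (e i)
  have hd : Continuous d := by fun_prop
  have hc : Continuous c := by
    refine continuous_pi fun i => ?_
    dsimp only [c]
    refine Fin.cases ?_ (fun k => ?_) (e i)
    · simpa using continuous_const
    · simp only [Fin.cons_succ]; fun_prop
  have hdc : ∀ s, d (c s) = s := fun s => by ext k; simp [d, c]
  have hd_eq : ∀ y k, d y k = y (e.symm k.succ) - y (e.symm 0) := fun _ _ => rfl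
  have hne : ∀ y ∈ nonconstantFunctions I, d y ≠ 0 := by
    rintro y ⟨i, j, hij⟩ h
    have key : ∀ m, y m = y (e.symm 0) := by
      intro m
      obtain ⟨m, rfl⟩ := e.symm.surjective m
      refine Fin.cases rfl (fun k => ?_) m
      have := hd_eq y k
      rw [h] at this
      simp at this
      linarith
    exact hij ((key i).trans (key j).symm)
  have hne' : ∀ y, d y ≠ 0 → y ∈ nonconstantFunctions I := by
    intro y h
    by_contra hy
    refine h (PiLp.ext fun k => ?_)
    rw [hd_eq]
    by_contra hk
    exact hy ⟨e.symm k.succ, e.symm 0, fun h => hk (by rw [h]; simp)⟩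
  let F : C(nonconstantFunctions I, Metric.sphere (0 : EuclideanSpace ℝ (Fin n)) 1) :=
    { toFun := fun y => ⟨‖d y‖⁻¹ • d y, by
        have := norm_ne_zero_iff.2 (hne y y.2)
        simp [norm_smul, this]⟩
      continuous_toFun := by
        have hd' : Continuous fun y : nonconstantFunctions I => d y.1 :=
          hd.comp continuous_subtype_val
        exact Continuous.subtype_mk ((hd'.norm.inv₀ fun y =>
          norm_ne_zero_iff.2 (hne y.1 y.2)).smul hd') _ }
  let G : C(Metric.sphere (0 : EuclideanSpace ℝ (Fin n)) 1, nonconstantFunctions I) :=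
    { toFun := fun s => ⟨c s, hne' _ (by
        rw [hdc]
        exact ne_zero_of_mem_unit_sphere s)⟩
      continuous_toFun := Continuous.subtype_mk (hc.comp continuous_subtype_val) _ }
  refine ⟨⟨F, G, ?_, ?_⟩⟩
  · have hmem : ∀ p : unitInterval × nonconstantFunctions I,
        (fun i => (1 - (p.1 : ℝ)) * c (‖d p.2‖⁻¹ • d p.2) i + p.1 * p.2.1 i) ∈
          nonconstantFunctions I := by
      rintro ⟨t, y⟩
      apply hne'
      have hy := hne y y.2
      -- Along the segment `d` stays a positive multiple of `d y`, so no constant is met.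
      have : d (fun i => (1 - (t : ℝ)) * c (‖d y‖⁻¹ • d y) i + t * y.1 i) =
          ((1 - (t : ℝ)) * ‖d y‖⁻¹ + t) • d y := by
        ext k
        have h1 : (‖d y‖⁻¹ • d y) k = c (‖d y‖⁻¹ • d y) (e.symm k.succ) -
          c (‖d y‖⁻¹ • d y) (e.symm 0) := by
          conv_lhs => rw [← hdc (‖d y‖⁻¹ • d y)]
        have h2 : (‖d y‖⁻¹ • d y) k = ‖d y‖⁻¹ * d y k := rfl
        have h3 : (((1 - (t : ℝ)) * ‖d y‖⁻¹ + t) • d y) k =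
          ((1 - (t : ℝ)) * ‖d y‖⁻¹ + t) * d y k := rfl
        rw [h3, hd_eq]
        rw [h2] at h1
        linear_combination (-(1 - (t : ℝ))) * h1 - t * hd_eq y k
      dsimp only
      rw [this]
      have hpos : 0 < ‖d y‖⁻¹ := inv_pos.2 (norm_pos_iff.2 hy)
      refine smul_ne_zero (ne_of_gt ?_) hy
      rcases t.2.1.lt_or_eq with h | h
      · exact add_pos_of_nonneg_of_pos (mul_nonneg (sub_nonneg.2 t.2.2) hpos.le) h
      · rw [← h]; simpa using hpos
    refine ⟨{ toFun := fun p => ⟨_, hmem p⟩, continuous_toFun := ?_, map_zero_left := ?_,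
              map_one_left := ?_ }⟩
    · refine Continuous.subtype_mk (continuous_pi fun i => ?_) _
      have h1 : Continuous fun p : unitInterval × nonconstantFunctions I => ‖d p.2‖⁻¹ • d p.2 :=
        continuous_subtype_val.comp (F.continuous.comp continuous_snd)
      have h2 := (continuous_apply i).comp (hc.comp h1)
      have h3 : Continuous fun p : unitInterval × nonconstantFunctions I => p.2.1 i := 
        (continuous_nonconstantFunctions_apply i).comp continuous_snd
      exact ((continuous_const.sub (continuous_subtype_val.comp continuous_fst)).mul h2).add
        ((continuous_subtype_val.comp continuous_fst).mul h3)
    · intro y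
      ext i
      simp [F, G]
    · intro y
      ext i
      simp
  · have : F.comp G = ContinuousMap.id _ := by
      ext1 s
      apply Subtype.ext
      simp [F, G, hdc]
    rw [this]

open Set in
/-- A map from the nonconstant functions on `I` to the union of the sets `X i` which sends the
functions that are maximal at `i` to `X i`. -/
theorem exists_map_of_nonconstantFunctions {E I : Type*} [TopologicalSpace E] [Fintype I]
    {X : I → Set E}
    (hX : ∀ S : Finset I, S.Nonempty → S ≠ Finset.univ → ContractibleSpace (⋂ i ∈ S, X i : Set E)) :
    ∃ g : nonconstantFunctions I → E, Continuous g ∧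
      ∀ y : nonconstantFunctions I, ∀ i, (∀ j, y.1 j ≤ y.1 i) → g y ∈ X i := by
  classical
  -- The cell of `T` consists of the functions maximal at every index outside `T`; `T = ∅` would
  -- force constancy. Smaller `T` gives a smaller cell and a smaller carrier.
  let J := {T : Finset I // T.Nonempty ∧ T ≠ Finset.univ}
  let e : J → Set (nonconstantFunctions I) := fun T => {y | ∀ i ∉ T.1, ∀ j, y.1 j ≤ y.1 i}
  let C : J → Set E := fun T => ⋂ i ∈ T.1ᶜ, X i
  have hCc : ∀ T, ContractibleSpace (C T) := fun T => hX _
    (Finset.nonempty_iff_ne_empty.2 fun h => T.2.2 (by simpa using h))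
    (fun h => T.2.1.ne_empty (by simpa using h))
  have he : ∀ T, IsClosed (e T) := by
    intro T
    simp only [e, ofPred_forall]
    refine isClosed_iInter fun i => isClosed_iInter fun _ => isClosed_iInter fun j =>
      isClosed_le (continuous_nonconstantFunctions_apply j) (continuous_nonconstantFunctions_apply i)
  have hmax : ∀ y : nonconstantFunctions I, ∃ i, ∀ j, y.1 j ≤ y.1 i := by
    intro y
    have : Nonempty I := ⟨y.2.choose⟩
    exact Finite.exists_max y.1
  have hmem : ∀ (y : nonconstantFunctions I) (T : Finset I), (∀ i ∉ T, ∀ j, y.1 j ≤ y.1 i) →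
      T.Nonempty := by
    intro y T hT
    rw [Finset.nonempty_iff_ne_empty]
    rintro rfl
    obtain ⟨i, j, hij⟩ := y.2
    exact hij ((hT j (by simp) i).antisymm (hT i (by simp) j))
  have hall : ∀ (y : nonconstantFunctions I) (i : I) (hi : ∀ j, y.1 j ≤ y.1 i),
      ∃ T : J, i ∉ T.1 ∧ y ∈ e T := by
    intro y i hi
    have h : ∀ k ∉ Finset.univ.erase i, ∀ j, y.1 j ≤ y.1 k := by
      intro k hk j
      obtain rfl : k = i := by simpa using hk
      exact hi j
    exact ⟨⟨Finset.univ.erase i, hmem y _ h, (Finset.erase_ssubset (Finset.mem_univ i)).ne⟩,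
      by simp, h⟩
  have hE : nonconstantFunctions I → Nonempty E := by
    intro y
    obtain ⟨i, hi⟩ := hmax y
    obtain ⟨T, -⟩ := hall y i hi
    have := hCc T
    exact (PathConnectedSpace.nonempty (X := C T)).map Subtype.val
  have key : ∃ g : nonconstantFunctions I → E, ContinuousOn g (∅ ∪ ⋃ T, e T) ∧
      EqOn g (fun y => (hE y).some) ∅ ∧ ∀ T, MapsTo g (e T) (C T) := by
    refine exists_continuousOn_carried (e := e) (A := ∅) (C := C) he isClosed_empty ?_ ?_ ?_ (continuousOn_empty _) (by simp [MapsTo])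
    · intro T T' h x hx
      simp only [C, mem_iInter, Finset.mem_compl] at hx ⊢
      exact fun i hi => hx i fun hi' => hi (h hi')
    · intro T T' y hT hT'
      have h : ∀ i ∉ T.1 ∩ T'.1, ∀ j, y.1 j ≤ y.1 i := by
        intro i hi j
        rw [Finset.mem_inter, not_and_or] at hi
        exact hi.elim (fun h => hT i h j) fun h => hT' i h j
      exact ⟨⟨T.1 ∩ T'.1, hmem y _ h, fun h => T.2.2
        (Finset.univ_subset_iff.1 (h.symm.subset.trans Finset.inter_subset_left))⟩,
        Finset.inter_subset_left (s₁ := T.1), Finset.inter_subset_right (s₁ := T.1), h⟩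
    · intro T φ hφ hφC
      have := hCc T
      obtain ⟨i₀, hi₀⟩ : ∃ i, i ∉ T.1 := by
        by_contra! h
        exact T.2.2 (Finset.eq_univ_iff_forall.2 h)
      have hev := continuous_nonconstantFunctions_apply (I := I)
      let M : nonconstantFunctions I → ℝ := fun y => T.1.sup' T.2.1 y.1
      let m : nonconstantFunctions I → ℝ := fun y => T.1.inf' T.2.1 y.1
      have hM : Continuous M :=
        Continuous.finset_sup'_apply T.2.1 fun i _ => hev i
      have hm : Continuous m :=
        Continuous.finset_inf'_apply T.2.1 fun i _ => hev i
      have hMle : ∀ y ∈ e T, M y ≤ y.1 i₀ := fun y hy => Finset.sup'_le _ _ fun j _ => hy i₀ hi₀ j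
      have hmlt : ∀ y ∈ e T, m y < y.1 i₀ := by
        intro y hy
        by_contra! h
        have key : ∀ j, y.1 j = y.1 i₀ := by
          intro j
          refine (hy i₀ hi₀ j).antisymm ?_
          by_cases hj : j ∈ T.1
          · exact h.trans (Finset.inf'_le _ hj)
          · exact hy j hj i₀
        obtain ⟨a, b, hab⟩ := y.2
        exact hab ((key a).trans (key b).symm)
      -- The values on `T` are raised together until the largest reaches the maximum. This gives a
      -- constant only if `y` is constant on `T`, which is where the ratio `u` below equals `1`.
      let r₀ : nonconstantFunctions I → I → ℝ := fun y i =>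
        if i ∈ T.1 then y.1 i + (y.1 i₀ - M y) else y.1 i
      have hr₀ : Continuous r₀ := by
        refine continuous_pi fun i => ?_
        dsimp only [r₀]
        split_ifs
        · exact (hev i).add ((hev i₀).sub hM)
        · exact hev i
      let u : nonconstantFunctions I → ℝ := fun y => (y.1 i₀ - M y) / (y.1 i₀ - m y)
      have hu1 : ∀ y ∈ e T, u y < 1 → ∃ k ∈ T.1, M y = y.1 k ∧ ∃ l ∈ T.1, y.1 l < y.1 k := by
        intro y hy hlt
        rw [div_lt_one (sub_pos.2 (hmlt y hy))] at hlt
        obtain ⟨k, hk, hk'⟩ := Finset.exists_mem_eq_sup' T.2.1 y.1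
        obtain ⟨l, hl, hl'⟩ := Finset.exists_mem_eq_inf' T.2.1 y.1
        refine ⟨k, hk, hk', l, hl, ?_⟩
        have h1 : M y = y.1 k := hk'
        have h2 : m y = y.1 l := hl'
        linarith
      have hr₀mem : ∀ y ∈ e T, u y < 1 → r₀ y ∈ nonconstantFunctions I := by
        intro y hy hlt
        obtain ⟨k, hk, -, l, hl, hkl⟩ := hu1 y hy hlt
        refine ⟨l, k, ?_⟩
        simp only [r₀, hl, hk, if_true]
        linarith
      let r : nonconstantFunctions I → nonconstantFunctions I := fun y =>
        if h : r₀ y ∈ nonconstantFunctions I then ⟨r₀ y, h⟩ else y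
      have hr : ∀ y, r₀ y ∈ nonconstantFunctions I → (r y).1 = r₀ y := by
        intro y hy
        simp [r, hy]
      have hMb : ∀ y ∈ e T ∩ (∅ ∪ ⋃ l < T, e l), M y = y.1 i₀ := by
        rintro y ⟨hy, hy' | hy'⟩
        · exact hy'.elim
        simp only [mem_iUnion] at hy'
        obtain ⟨T', hT', hy'⟩ := hy'
        obtain ⟨k, hk, hk'⟩ := Finset.exists_of_ssubset (show T'.1 ⊂ T.1 from hT')
        exact (hMle y hy).antisymm ((hy' k hk' i₀).trans (Finset.le_sup' y.1 hk))
      refine exists_extension_of_contractible (u := u) (r := r) ?_ ?_ ?_ ?_ ?_ hφ hφC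
      · refine ContinuousOn.div ((hev i₀).sub hM).continuousOn ((hev i₀).sub hm).continuousOn fun y hy => ?_
        exact (sub_pos.2 (hmlt y hy)).ne'
      · intro y hy
        simp [u, hMb y hy]
      · rw [Topology.IsInducing.subtypeVal.continuousOn_iff]
        exact hr₀.continuousOn.congr fun y hy => hr y (hr₀mem y hy.1 hy.2)
      · intro y hy hlt
        obtain ⟨k, hk, hMk, l, hl, hkl⟩ := hu1 y hy hlt
        have hr' := hr y (hr₀mem y hy hlt)
        have hle : ∀ j, (r y).1 j ≤ y.1 i₀ := by
          intro j
          rw [hr']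
          dsimp only [r₀]
          split_ifs with hj
          · have : y.1 j ≤ M y := Finset.le_sup' y.1 hj
            linarith
          · exact hy i₀ hi₀ j
        have hout : ∀ i ∉ T.1, (r y).1 i = y.1 i₀ := by
          intro i hi
          rw [hr']
          simp only [r₀, hi, if_false]
          exact (hy i₀ hi₀ i).antisymm (hy i hi i₀)
        refine ⟨fun i hi j => (hle j).trans_eq (hout i hi).symm, Or.inr ?_⟩
        have hlk : l ≠ k := by rintro rfl; exact hkl.false
        -- The index `k` that has reached the maximum can be dropped from `T`; `l` remains.
        refine mem_biUnion (x := ⟨T.1.erase k, ⟨l, Finset.mem_erase.2 ⟨hlk, hl⟩⟩, fun h =>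
          Finset.notMem_erase k T.1 (h.symm.subset (Finset.mem_univ k))⟩) (Finset.erase_ssubset hk) ?_
        intro i hi j
        refine (hle j).trans_eq ?_
        by_cases hik : i = k
        · subst hik
          rw [hr']
          simp only [r₀, hk, if_true]
          linarith
        · exact (hout i fun h => hi (Finset.mem_erase.2 ⟨hik, h⟩)).symm
      · intro y hy
        have h0 : r₀ y = y.1 := by
          funext i
          simp [r₀, hMb y hy]
        exact Subtype.ext ((hr y (h0 ▸ y.2)).trans h0)
  obtain ⟨g, hg, -, hgC⟩ := key
  refine ⟨g, ?_, fun y i hi => ?_⟩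
  · rw [← continuousOn_univ]
    refine hg.mono fun y _ => Or.inr ?_
    obtain ⟨i, hi⟩ := hmax y
    obtain ⟨T, -, hT⟩ := hall y i hi
    exact mem_iUnion.2 ⟨T, hT⟩
  · obtain ⟨T, hiT, hT⟩ := hall y i hi
    exact mem_iInter₂.1 (hgC T hT) i (by simpa using hiT)

/-! ### Closed simplices, realizations and prisms -/

section GeometricRealization

variable {V : Type u} [Fintype V]

open Set

/-- The closed simplex spanned by the vertices in `σ`. -/
def closedSimplex (σ : Finset V) : Set (V → ℝ) := {x | x ∈ stdSimplex ℝ V ∧ ∀ a ∉ σ, x a = 0}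

theorem isClosed_closedSimplex (σ : Finset V) : IsClosed (closedSimplex σ) := by
  refine IsClosed.inter (isClosed_stdSimplex ℝ V) ?_
  change IsClosed {x : V → ℝ | ∀ a ∉ σ, x a = 0}
  simp only [ofPred_forall]
  exact isClosed_iInter fun a => isClosed_iInter fun _ =>
    isClosed_eq (continuous_apply a) continuous_const

theorem nonempty_of_mem_closedSimplex {σ : Finset V} {x : V → ℝ} (hx : x ∈ closedSimplex σ) :
    σ.Nonempty := by
  rw [Finset.nonempty_iff_ne_empty]
  rintro rfl
  have := hx.1.2
  simp [fun a => hx.2 a (Finset.notMem_empty a)] at this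

theorem sum_of_mem_closedSimplex {σ : Finset V} {x : V → ℝ} (hx : x ∈ closedSimplex σ) :
    ∑ a ∈ σ, x a = 1 := by
  rw [← hx.1.2]
  exact Finset.sum_subset (Finset.subset_univ σ) fun a _ ha => hx.2 a ha

/-- The support of a point of the closed simplex is a nonempty subset of `σ`, hence itself a face.
-/
theorem closedSimplex_subset_geomRealization {K : PreAbstractSimplicialComplex V} {σ : Finset V}
    (hσ : σ ∈ K.faces) : closedSimplex σ ⊆ geomRealization K := by
  classical
  intro x hx
  have hsub : Finset.univ.filter (fun a => x a ≠ 0) ⊆ σ := fun a ha => by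
    by_contra h
    exact (Finset.mem_filter.1 ha).2 (hx.2 a h)
  have hmem : x ∈ closedSimplex (Finset.univ.filter fun a => x a ≠ 0) :=
    ⟨hx.1, fun a ha => by simpa using ha⟩
  exact ⟨hx.1, _, (K.isRelLowerSet_faces hσ).2 hsub (nonempty_of_mem_closedSimplex hmem),
    by simp⟩

theorem mem_geomRealization_iff {K : PreAbstractSimplicialComplex V} {x : V → ℝ} :
    x ∈ geomRealization K ↔ ∃ σ ∈ K.faces, x ∈ closedSimplex σ := by
  constructor
  · rintro ⟨hx, σ, hσ, h⟩
    exact ⟨σ, hσ, hx, fun a ha => by simpa [h] using ha⟩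
  · rintro ⟨σ, hσ, hx⟩
    exact closedSimplex_subset_geomRealization hσ hx

theorem isClosed_geomRealization (K : PreAbstractSimplicialComplex V) :
    IsClosed (geomRealization K) := by
  have : geomRealization K = ⋃ σ ∈ K.faces, closedSimplex σ := by
    ext x
    simp [mem_geomRealization_iff]
  rw [this]
  exact (toFinite K.faces).isClosed_biUnion fun σ _ => isClosed_closedSimplex σ

theorem mem_faces_iSup {V : Type*} {I : Type*} {X : I → PreAbstractSimplicialComplex V} {σ : Finset V} :
    σ ∈ (⨆ i, X i).faces ↔ ∃ i, σ ∈ (X i).faces := by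
  change σ ∈ ⋃ K ∈ range X, K.faces ↔ _
  simp

theorem geomRealization_iSup {I : Type*} (X : I → PreAbstractSimplicialComplex V) :
    geomRealization (⨆ i, X i) = ⋃ i, geomRealization (X i) := by
  ext x
  simp only [geomRealization, mem_iUnion, mem_ofPred_eq, mem_faces_iSup]
  tauto

/-- The product of a simplex with the unit interval: a map to a contractible set extends from the
boundary. -/
theorem exists_extension_prism {Z : Type*} [TopologicalSpace Z] {C : Set Z} [ContractibleSpace C]
    {σ : Finset V} {b : Set (ℝ × (V → ℝ))}
    (hb : ∀ p ∈ Icc (0 : ℝ) 1 ×ˢ closedSimplex σ,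
      p ∈ b ↔ p.1 = 0 ∨ p.1 = 1 ∨ ∃ a ∈ σ, p.2 a = 0)
    (hbσ : b ⊆ Icc (0 : ℝ) 1 ×ˢ closedSimplex σ)
    {φ : ℝ × (V → ℝ) → Z} (hφ : ContinuousOn φ b) (hφC : MapsTo φ b C) :
    ∃ ψ : ℝ × (V → ℝ) → Z, ContinuousOn ψ (Icc (0 : ℝ) 1 ×ˢ closedSimplex σ) ∧ EqOn ψ φ b ∧
      MapsTo ψ (Icc (0 : ℝ) 1 ×ˢ closedSimplex σ) C := by
  classical
  rcases σ.eq_empty_or_nonempty with rfl | hσ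
  · have : closedSimplex (∅ : Finset V) = ∅ := by
      ext x
      exact ⟨fun hx => (Finset.not_nonempty_empty (nonempty_of_mem_closedSimplex hx)).elim,
        fun hx => hx.elim⟩
    exact ⟨φ, by simp [this], fun _ _ => rfl, by simp [this, MapsTo]⟩
  obtain ⟨k, hkdef⟩ : ∃ k : ℝ, k = σ.card := ⟨_, rfl⟩
  have hk : 0 < k := hkdef ▸ Nat.cast_pos.2 hσ.card_pos
  let m : ℝ × (V → ℝ) → ℝ := fun p => σ.inf' hσ p.2
  have hm : Continuous m := Continuous.finset_inf'_apply hσ fun a _ => by fun_prop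
  -- Gauge of the prism about its center (time `1/2`, all coordinates `1/k`): `0` there, `1` on the
  -- boundary. The map `r` below is radial projection from that center.
  let ρ : ℝ × (V → ℝ) → ℝ := fun p => max (1 - k * m p) |2 * p.1 - 1|
  have hρ : Continuous ρ := by fun_prop
  have hmle : ∀ p, ∀ a ∈ σ, m p ≤ p.2 a := fun p a ha => Finset.inf'_le _ ha
  have hm0 : ∀ p ∈ Icc (0 : ℝ) 1 ×ˢ closedSimplex σ, 0 ≤ m p := fun p hp =>
    Finset.le_inf' _ _ fun a _ => hp.2.1.1 a
  let r : ℝ × (V → ℝ) → ℝ × (V → ℝ) := fun p =>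
    (1 / 2 + (p.1 - 1 / 2) / ρ p, fun a => if a ∈ σ then 1 / k + (p.2 a - 1 / k) / ρ p else 0)
  have hρb : ∀ p ∈ b, ρ p = 1 := by
    intro p hp
    have hpσ := hbσ hp
    have h1 : 1 - k * m p ≤ 1 := by nlinarith [hm0 p hpσ]
    have h2 : |2 * p.1 - 1| ≤ 1 := abs_le.2 ⟨by linarith [hpσ.1.1], by linarith [hpσ.1.2]⟩
    refine (max_le h1 h2).antisymm ?_
    rcases (hb p hpσ).1 hp with h | h | ⟨a, ha, h⟩
    · exact le_max_of_le_right (by rw [h]; norm_num)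
    · exact le_max_of_le_right (by rw [h]; norm_num)
    · have := hmle p a ha
      exact le_max_of_le_left (by nlinarith)
  have hrσ : ∀ p ∈ Icc (0 : ℝ) 1 ×ˢ closedSimplex σ, 0 < ρ p →
      r p ∈ Icc (0 : ℝ) 1 ×ˢ closedSimplex σ := by
    intro p hp h0
    have h2 : |2 * p.1 - 1| ≤ ρ p := le_max_right _ _
    have h3 := abs_le.1 h2
    refine ⟨⟨?_, ?_⟩, ⟨fun a => ?_, ?_⟩, fun a ha => if_neg ha⟩
    · have : -(1 / 2) ≤ (p.1 - 1 / 2) / ρ p := (le_div_iff₀ h0).2 (by linarith)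
      simp only [r]
      linarith
    · have : (p.1 - 1 / 2) / ρ p ≤ 1 / 2 := (div_le_iff₀ h0).2 (by linarith)
      simp only [r]
      linarith
    · simp only [r]
      split_ifs with ha
      · have h4 : 1 - k * p.2 a ≤ ρ p :=
          (sub_le_sub_left (mul_le_mul_of_nonneg_left (hmle p a ha) hk.le) 1).trans
            (le_max_left _ _)
        have : -(1 / k) ≤ (p.2 a - 1 / k) / ρ p := by
          rw [le_div_iff₀ h0]
          have : 1 / k * (1 - k * p.2 a) ≤ 1 / k * ρ p :=
            mul_le_mul_of_nonneg_left h4 (by positivity)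
          have h5 : 1 / k * (1 - k * p.2 a) = 1 / k - p.2 a := by field_simp
          linarith
        linarith
      · exact le_rfl
    · simp only [r]
      have hone : ∑ _a ∈ σ, 1 / k = 1 := by
        rw [Finset.sum_const, nsmul_eq_mul, ← hkdef, mul_one_div_cancel hk.ne']
      have hzero : ∑ a ∈ σ, (p.2 a - 1 / k) / ρ p = 0 := by
        rw [← Finset.sum_div, Finset.sum_sub_distrib, sum_of_mem_closedSimplex hp.2, hone, sub_self,
          zero_div]
      rw [Finset.sum_ite_mem, Finset.univ_inter, Finset.sum_add_distrib, hone, hzero, add_zero]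
  refine exists_extension_of_contractible (u := fun p => 1 - ρ p) (r := r)
    (by fun_prop) (fun p hp => by simp [hρb p hp]) ?_ ?_ ?_ hφ hφC
  · have hne : ∀ p ∈ {p ∈ Icc (0 : ℝ) 1 ×ˢ closedSimplex σ | 1 - ρ p < 1}, ρ p ≠ 0 := by
      intro p hp
      have := hp.2
      exact ne_of_gt (by linarith)
    refine ContinuousOn.prodMk ?_ (continuousOn_pi.2 fun a => ?_)
    · exact continuousOn_const.add (ContinuousOn.div (by fun_prop) hρ.continuousOn hne)
    · by_cases ha : a ∈ σ
      · simp only [ha, if_true]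
        exact continuousOn_const.add (ContinuousOn.div (by fun_prop) hρ.continuousOn hne)
      · simp only [ha, if_false]
        exact continuousOn_const
  · intro p hp hlt
    have h0 : 0 < ρ p := by linarith
    refine (hb _ (hrσ p hp h0)).2 ?_
    rcases max_choice (1 - k * m p) |2 * p.1 - 1| with h | h
    · right; right
      obtain ⟨a, ha, ha'⟩ := Finset.exists_mem_eq_inf' hσ p.2
      have h5 : ρ p = 1 - k * p.2 a := h.trans (by rw [← ha'])
      refine ⟨a, ha, ?_⟩
      simp only [r, ha, if_true]
      have h6 : p.2 a - 1 / k = -(1 / k) * ρ p := by rw [h5]; field_simp; ring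
      rw [h6, mul_div_cancel_right₀ _ h0.ne']
      ring
    · have h5 : ρ p = |2 * p.1 - 1| := h
      rcases le_total 0 (2 * p.1 - 1) with h6 | h6
      · right; left
        rw [abs_of_nonneg h6] at h5
        have h7 : p.1 - 1 / 2 = 1 / 2 * ρ p := by rw [h5]; ring
        simp only [r]
        rw [h7, mul_div_cancel_right₀ _ h0.ne']
        norm_num
      · left
        rw [abs_of_nonpos h6] at h5
        have h7 : p.1 - 1 / 2 = -(1 / 2) * ρ p := by rw [h5]; ring
        simp only [r]
        rw [h7, mul_div_cancel_right₀ _ h0.ne']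
        norm_num
  · intro p hp
    have hpσ := hbσ hp
    refine Prod.ext ?_ (funext fun a => ?_)
    · simp [r, hρb p hp]
    · by_cases ha : a ∈ σ
      · simp [r, hρb p hp, ha]
      · simp [r, ha, hpσ.2.2 a ha]

end GeometricRealization

/-! ### Homotopy type of the covered complex -/

section Nerve

variable {V : Type u} [Fintype V] {I : Type w} [Fintype I]

open Set

/-- If all proper intersections of the subcomplexes `X i` are contractible and their common
intersection is empty, then a self-map of the union which preserves each of them is homotopic to the
identity. -/
theorem homotopic_id_of_mapsTo {X : I → PreAbstractSimplicialComplex V}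
    (hX : ∀ S : Finset I, S.Nonempty → S ≠ Finset.univ →
      ContractibleSpace (⋂ i ∈ S, geomRealization (X i) : Set (V → ℝ)))
    (hempty : ⋂ i, geomRealization (X i) = ∅)
    (h : C(geomRealization (⨆ i, X i), geomRealization (⨆ i, X i)))
    (hh : ∀ x i, x.1 ∈ geomRealization (X i) → (h x).1 ∈ geomRealization (X i)) :
    h.Homotopic (ContinuousMap.id _) := by
  classical
  let K := ⨆ i, X i
  let T := geomRealization K
  let J := {σ : Finset V // σ ∈ K.faces ∧ σ.Nonempty}
  -- Prisms over simplices; the ends `A` carry `h` at time `0` and the identity at time `1`. A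
  -- larger simplex lies in fewer `X i`, so its carrier `C` is larger.
  let e : J → Set (ℝ × (V → ℝ)) := fun σ => Icc (0 : ℝ) 1 ×ˢ closedSimplex σ.1
  let A : Set (ℝ × (V → ℝ)) := ({0, 1} : Set ℝ) ×ˢ T
  let S : J → Finset I := fun σ => Finset.univ.filter fun i => σ.1 ∈ (X i).faces
  let C : J → Set (V → ℝ) := fun σ => ⋂ i ∈ S σ, geomRealization (X i)
  let h' : (V → ℝ) → V → ℝ := fun x => if hx : x ∈ T then h ⟨x, hx⟩ else x
  have h'_eq : ∀ x (hx : x ∈ T), h' x = h ⟨x, hx⟩ := fun x hx => dif_pos hx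
  have h'_cont : ContinuousOn h' T := by
    rw [continuousOn_iff_continuous_domRestrict]
    exact (continuous_subtype_val.comp h.continuous).congr fun x => (h'_eq x.1 x.2).symm
  let g₀ : ℝ × (V → ℝ) → V → ℝ := fun p => if p.1 = 0 then h' p.2 else p.2
  have hCc : ∀ σ, ContractibleSpace (C σ) := by
    intro σ
    refine hX (S σ) ?_ fun hS => ?_
    · obtain ⟨i, hi⟩ := mem_faces_iSup.1 σ.2.1
      exact ⟨i, by simpa [S] using hi⟩
    · obtain ⟨a, ha⟩ := σ.2.2
      -- If `σ` lay in every `X i`, its vertex `a` would be a common point.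
      have hmem : (Pi.single a 1 : V → ℝ) ∈ closedSimplex σ.1 := by
        refine ⟨single_mem_stdSimplex ℝ a, fun b hb => Pi.single_eq_of_ne ?_ _⟩
        rintro rfl
        exact hb ha
      have : (Pi.single a 1 : V → ℝ) ∈ ⋂ i, geomRealization (X i) := mem_iInter.2 fun i =>
        closedSimplex_subset_geomRealization
          (Finset.mem_filter.1 (hS.symm.subset (Finset.mem_univ i))).2 hmem
      rw [hempty] at this
      exact this
  have hsub : ∀ (σ : J) (τ : Finset V), τ ⊆ σ.1 → τ.Nonempty → τ ∈ K.faces := fun σ τ h1 h2 =>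
    (K.isRelLowerSet_faces σ.2.1).2 h1 h2
  have key : ∃ g : ℝ × (V → ℝ) → V → ℝ, ContinuousOn g (A ∪ ⋃ σ, e σ) ∧ EqOn g g₀ A ∧
      ∀ σ, MapsTo g (e σ) (C σ) := by
    refine exists_continuousOn_carried
      (fun σ => isClosed_Icc.prod (isClosed_closedSimplex σ.1))
      ((toFinite _).isClosed.prod (isClosed_geomRealization K)) ?_ ?_ ?_ ?_ ?_
    · intro σ τ hστ x hx
      simp only [C, S, mem_iInter, Finset.mem_filter, Finset.mem_univ, true_and] at hx ⊢
      exact fun i hi => hx i (((X i).isRelLowerSet_faces hi).2 hστ σ.2.2)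
    · rintro σ τ p hσ hτ
      have hmem : p.2 ∈ closedSimplex (σ.1 ∩ τ.1) := by
        refine ⟨hσ.2.1, fun a ha => ?_⟩
        rw [Finset.mem_inter, not_and_or] at ha
        exact ha.elim (hσ.2.2 a) (hτ.2.2 a)
      have hne := nonempty_of_mem_closedSimplex hmem
      exact ⟨⟨σ.1 ∩ τ.1, hsub σ _ Finset.inter_subset_left hne, hne⟩,
        Finset.inter_subset_left (s₁ := σ.1), Finset.inter_subset_right (s₁ := σ.1), hσ.1, hmem⟩
    · intro σ φ hφ hφC
      have := hCc σ
      refine exists_extension_prism (fun p hp => ?_) inter_subset_left hφ hφC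
      constructor
      · rintro ⟨-, hA | hl⟩
        · rcases hA.1 with h | h
          · exact Or.inl h
          · exact Or.inr (Or.inl h)
        · simp only [mem_iUnion] at hl
          obtain ⟨τ, hτ, hp'⟩ := hl
          obtain ⟨a, ha, ha'⟩ := Finset.exists_of_ssubset (show τ.1 ⊂ σ.1 from hτ)
          exact Or.inr (Or.inr ⟨a, ha, hp'.2.2 a ha'⟩)
      · have hpT := closedSimplex_subset_geomRealization σ.2.1 hp.2
        rintro (h | h | ⟨a, ha, h⟩)
        · exact ⟨hp, Or.inl ⟨Or.inl h, hpT⟩⟩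
        · exact ⟨hp, Or.inl ⟨Or.inr h, hpT⟩⟩
        · have hmem : p.2 ∈ closedSimplex (σ.1.erase a) := by
            refine ⟨hp.2.1, fun b hb => ?_⟩
            by_cases hba : b = a
            · rw [hba, h]
            · exact hp.2.2 b fun hb' => hb (Finset.mem_erase.2 ⟨hba, hb'⟩)
          have hne := nonempty_of_mem_closedSimplex hmem
          exact ⟨hp, Or.inr (mem_biUnion (x := (⟨σ.1.erase a,
            hsub σ _ (Finset.erase_subset a σ.1) hne, hne⟩ : J))
            (Finset.erase_ssubset ha) ⟨hp.1, hmem⟩)⟩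
    · have h0 : ContinuousOn g₀ (({0} : Set ℝ) ×ˢ T) :=
        (h'_cont.comp continuousOn_snd fun p hp => hp.2).congr fun p hp => if_pos hp.1
      have h1 : ContinuousOn g₀ (({1} : Set ℝ) ×ˢ T) :=
        continuousOn_snd.congr fun p hp => if_neg (by rw [show p.1 = 1 from hp.1]; norm_num)
      have hT := isClosed_geomRealization K
      have := h0.union_of_isClosed h1 (isClosed_singleton.prod hT) (isClosed_singleton.prod hT)
      rwa [← union_prod, singleton_union] at this
    · rintro σ p ⟨hA, hp⟩
      refine mem_iInter₂.2 fun i hi => ?_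
      have hi' := (Finset.mem_filter.1 hi).2
      have hpi := closedSimplex_subset_geomRealization hi' hp.2
      simp only [g₀]
      split_ifs
      · rw [h'_eq p.2 hA.2]
        exact hh ⟨p.2, hA.2⟩ i hpi
      · exact hpi
  obtain ⟨g, hg, hgA, hgC⟩ := key
  have hcell : ∀ x ∈ T, ∃ σ : J, x ∈ closedSimplex σ.1 := by
    intro x hx
    obtain ⟨σ, hσ, hx⟩ := mem_geomRealization_iff.1 hx
    exact ⟨⟨σ, hσ, nonempty_of_mem_closedSimplex hx⟩, hx⟩
  have hgT : ∀ t ∈ Icc (0 : ℝ) 1, ∀ x ∈ T, g (t, x) ∈ T := by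
    intro t ht x hx
    obtain ⟨σ, hσ⟩ := hcell x hx
    obtain ⟨i, hi⟩ := mem_faces_iSup.1 σ.2.1
    have := mem_iInter₂.1 (hgC σ (show (t, x) ∈ e σ from ⟨ht, hσ⟩)) i (by simpa [S] using hi)
    simp only [T, K, geomRealization_iSup]
    exact mem_iUnion.2 ⟨i, this⟩
  refine ⟨{ toFun := fun p => ⟨g (p.1, p.2), hgT _ p.1.2 _ p.2.2⟩, continuous_toFun := ?_,
            map_zero_left := fun x => ?_, map_one_left := fun x => ?_ }⟩
  · refine Continuous.subtype_mk (hg.comp_continuous (by fun_prop) fun p => Or.inr ?_) _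
    obtain ⟨σ, hσ⟩ := hcell p.2 p.2.2
    exact mem_iUnion.2 ⟨σ, p.1.2, hσ⟩
  · refine Subtype.ext ((hgA ⟨Or.inl rfl, x.2⟩).trans ?_)
    simp only [g₀]
    exact (if_pos rfl).trans (h'_eq x.1 x.2)
  · refine Subtype.ext ((hgA (show ((1 : ℝ), x.1) ∈ A from ⟨Or.inr rfl, x.2⟩)).trans ?_)
    exact if_neg (by simp)

/-- A complex covered by subcomplexes whose proper intersections are contractible and whose common
intersection is empty is homotopy equivalent to the space of nonconstant functions on the index
set. -/
theorem nonempty_homotopyEquiv_nonconstantFunctions {X : I → PreAbstractSimplicialComplex V}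
    (hX : ∀ S : Finset I, S.Nonempty → S ≠ Finset.univ →
      ContractibleSpace (⋂ i ∈ S, geomRealization (X i) : Set (V → ℝ)))
    (hempty : ⋂ i, geomRealization (X i) = ∅) :
    Nonempty (ContinuousMap.HomotopyEquiv (geomRealization (⨆ i, X i))
      (nonconstantFunctions I)) := by
  classical
  have hfX : ∀ x ∈ geomRealization (⨆ i, X i), ∀ i,
      x ∉ geomRealization (X i) → 0 < Metric.infDist x (geomRealization (X i)) := by
    intro x hx i hi
    rw [geomRealization_iSup] at hx
    obtain ⟨j, hj⟩ := mem_iUnion.1 hx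
    have hij : i ≠ j := by
      rintro rfl
      exact hi hj
    have := hX {i} (Finset.singleton_nonempty i) fun h => hij
      (Finset.mem_singleton.1 (h.symm.subset (Finset.mem_univ j))).symm
    -- Needed because `Metric.infDist` to the empty set is `0` by convention.
    have hne : (geomRealization (X i)).Nonempty := by
      obtain ⟨y, hy⟩ := PathConnectedSpace.nonempty
        (X := (⋂ j ∈ ({i} : Finset I), geomRealization (X j) : Set (V → ℝ)))
      exact ⟨y, by simpa using hy⟩
    exact ((isClosed_geomRealization (X i)).notMem_iff_infDist_pos hne).1 hi
  have hfmem : ∀ x ∈ geomRealization (⨆ i, X i),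
      (fun i => -Metric.infDist x (geomRealization (X i))) ∈ nonconstantFunctions I := by
    intro x hx
    obtain ⟨i, hi⟩ := mem_iUnion.1 (geomRealization_iSup X ▸ hx)
    obtain ⟨j, hj⟩ : ∃ j, x ∉ geomRealization (X j) := by
      by_contra! h
      have : x ∈ ⋂ i, geomRealization (X i) := mem_iInter.2 h
      rw [hempty] at this
      exact this
    refine ⟨i, j, ne_of_gt ?_⟩
    dsimp only
    rw [Metric.infDist_zero_of_mem hi]
    exact neg_lt_neg (hfX x hx j hj)
  let f : C(geomRealization (⨆ i, X i), nonconstantFunctions I) :=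
    { toFun := fun x => ⟨_, hfmem x.1 x.2⟩
      continuous_toFun := Continuous.subtype_mk (continuous_pi fun i =>
        ((Metric.continuous_infDist_pt _).comp continuous_subtype_val).neg) _ }
  have hf : ∀ x i, x.1 ∈ geomRealization (X i) → ∀ j, (f x).1 j ≤ (f x).1 i := by
    intro x i hi j
    change -Metric.infDist _ _ ≤ -Metric.infDist _ _
    rw [Metric.infDist_zero_of_mem hi]
    exact neg_le_neg Metric.infDist_nonneg
  obtain ⟨g₀, hg₀, hg₀X⟩ := exists_map_of_nonconstantFunctions hX
  have hg₀mem : ∀ y, g₀ y ∈ geomRealization (⨆ i, X i) := by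
    intro y
    have : Nonempty I := ⟨y.2.choose⟩
    obtain ⟨i, hi⟩ := Finite.exists_max y.1
    rw [geomRealization_iSup]
    exact mem_iUnion.2 ⟨i, hg₀X y i hi⟩
  let g : C(nonconstantFunctions I, geomRealization (⨆ i, X i)) :=
    { toFun := fun y => ⟨g₀ y, hg₀mem y⟩
      continuous_toFun := hg₀.subtype_mk _ }
  refine ⟨⟨f, g, homotopic_id_of_mapsTo hX hempty _ fun x i hi => hg₀X _ i (hf x i hi), ?_⟩⟩
  have hmem : ∀ p : unitInterval × nonconstantFunctions I,
      (fun i => (1 - (p.1 : ℝ)) * (f (g p.2)).1 i + p.1 * p.2.1 i) ∈ nonconstantFunctions I := by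
    rintro ⟨t, y⟩
    have : Nonempty I := ⟨y.2.choose⟩
    obtain ⟨i, hi⟩ := Finite.exists_max y.1
    exact nonconstantFunctions_segment (f (g y)).2 y.2 (hf (g y) i (hg₀X y i hi)) hi t.2.1 t.2.2
  refine ⟨{ toFun := fun p => ⟨_, hmem p⟩, continuous_toFun := ?_, map_zero_left := ?_,
            map_one_left := ?_ }⟩
  · refine Continuous.subtype_mk (continuous_pi fun i => ?_) _
    have h1 := (continuous_nonconstantFunctions_apply i).comp
      ((f.continuous.comp g.continuous).comp (continuous_snd (X := unitInterval)))
    have h2 := (continuous_nonconstantFunctions_apply i).comp (continuous_snd (X := unitInterval))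
    have h3 : Continuous fun p : unitInterval × nonconstantFunctions I => (p.1 : ℝ) :=
      continuous_subtype_val.comp continuous_fst
    exact ((continuous_const.sub h3).mul h1).add (h3.mul h2)
  · intro y
    ext i
    simp
  · intro y
    ext i
    simp

/-- A complex covered by `n + 1` subcomplexes whose proper intersections are contractible and whose
common intersection is empty has the cohomology of the unit sphere of `ℝⁿ`. -/
theorem hasCohomologyOfUnitSphere_of_cover {X : I → PreAbstractSimplicialComplex V} {n : ℕ}
    (hI : Fintype.card I = n + 1)
    (hX : ∀ S : Finset I, S.Nonempty → S ≠ Finset.univ →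
      ContractibleSpace (⋂ i ∈ S, geomRealization (X i) : Set (V → ℝ)))
    (hempty : ⋂ i, geomRealization (X i) = ∅) :
    HasCohomologyOfUnitSphere (geomRealization (⨆ i, X i)) n := by
  obtain ⟨e⟩ := nonempty_homotopyEquiv_nonconstantFunctions hX hempty
  obtain ⟨e'⟩ := nonempty_homotopyEquiv_nonconstantFunctions_sphere hI
  exact hasCohomologyOfUnitSphere_of_homotopyEquiv (e.trans e')

end Nerve

/-! ### Cones and the Davis chamber -/

/-- The realization of a complex that is a cone is contractible. -/
theorem contractibleSpace_geomRealization_of_cone {V : Type u} [Fintype V] [DecidableEq V]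
    {K : PreAbstractSimplicialComplex V} (v : V) (hv : {v} ∈ K.faces)
    (hK : ∀ t ∈ K.faces, insert v t ∈ K.faces) : ContractibleSpace (geomRealization K) := by
  have hmem : (Pi.single v 1 : V → ℝ) ∈ geomRealization K :=
    closedSimplex_subset_geomRealization hv ⟨single_mem_stdSimplex ℝ v, fun b hb =>
      Pi.single_eq_of_ne (by simpa using hb) _⟩
  have hstar : StarConvex ℝ (Pi.single v 1 : V → ℝ) (geomRealization K) := by
    intro x hx a b ha hb hab
    obtain ⟨t, ht, hxt⟩ := mem_geomRealization_iff.1 hx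
    refine closedSimplex_subset_geomRealization (hK t ht) ⟨?_, fun c hc => ?_⟩
    · exact convex_stdSimplex ℝ V (single_mem_stdSimplex ℝ v) hxt.1 ha hb hab
    · rw [Finset.mem_insert, not_or] at hc
      simp [Pi.single_eq_of_ne hc.1, hxt.2 c hc.2]
  exact hstar.contractibleSpace ⟨_, hmem⟩

section DavisChamber

variable {B : Type u} {M : CoxeterMatrix B} {W : Type v} [Group W] (cs : CoxeterSystem M W)

theorem parabolicSubgroup_mono {J J' : Set B} (h : J ⊆ J') :
    parabolicSubgroup cs J ≤ parabolicSubgroup cs J' :=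
  Subgroup.closure_mono (Set.image_mono h)

theorem finite_parabolicSubgroup_of_subset {J J' : Set B} (h : J ⊆ J')
    (hfin : Finite (parabolicSubgroup cs J')) : Finite (parabolicSubgroup cs J) :=
  Finite.of_injective _ (Subgroup.inclusion_injective (parabolicSubgroup_mono cs h))

theorem parabolicSubgroup_univ : parabolicSubgroup cs Set.univ = ⊤ := by
  rw [parabolicSubgroup, Set.image_univ, cs.subgroup_closure_range_simple]

theorem finite_parabolicSubgroup_empty : Finite (parabolicSubgroup cs ∅) := by
  rw [parabolicSubgroup, Set.image_empty, Subgroup.closure_empty]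
  infer_instance

theorem finite_parabolicSubgroup_singleton (s : B) : Finite (parabolicSubgroup cs {s}) := by
  rw [parabolicSubgroup, Set.image_singleton, ← Subgroup.zpowers_eq_closure]
  exact finite_zpowers.2 (isOfFinOrder_iff_pow_eq_one.2 ⟨2, two_pos, by rw [sq]; simp⟩)

theorem infinite_of_infinite_parabolicSubgroup {J : Set B}
    (h : Infinite (parabolicSubgroup cs J)) : Infinite W :=
  Infinite.of_injective _ (Subgroup.subtype_injective (parabolicSubgroup cs J))

/-- Fails for `σ = ∅` in general: faces of a facet are nonempty, so the left side would be trivial.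
-/
theorem faceParabolic_eq {σ : Finset B} (hσ : σ.Nonempty) :
    faceParabolic cs σ = parabolicSubgroup cs {s | s ∉ σ} := by
  rw [faceParabolic]
  congr 1
  ext s
  exact and_iff_right hσ

theorem IsMinimalInfinite.two_le_card {cs : CoxeterSystem M W} {J : Finset B}
    (h : IsMinimalInfinite cs J) : 2 ≤ J.card := by
  by_contra! hlt
  refine not_finite_iff_infinite.2 h.1 ?_
  rcases Nat.lt_succ_iff_lt_or_eq.1 hlt with h0 | h1
  · rw [Finset.card_eq_zero.1 (Nat.lt_one_iff.1 h0), Finset.coe_empty]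
    exact finite_parabolicSubgroup_empty cs
  · obtain ⟨s, rfl⟩ := Finset.card_eq_one.1 h1
    rw [Finset.coe_singleton]
    exact finite_parabolicSubgroup_singleton cs s

/-- The intersection of the facets `D_s`, `s ∈ J`, of the Davis chamber. -/
def davisFacetInter (J : Finset B) : PreAbstractSimplicialComplex (Finset B) where
  faces := {t | t ∈ (davisChamber cs).faces ∧ ∀ σ ∈ t, ∀ s ∈ J, s ∉ σ}
  isRelLowerSet_faces := fun _ ht =>
    ⟨((davisChamber cs).isRelLowerSet_faces ht.1).1, fun _ h hne =>
      ⟨((davisChamber cs).isRelLowerSet_faces ht.1).2 h hne, fun σ hσ => ht.2 σ (h hσ)⟩⟩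

theorem mem_davisFacet_faces {s : B} {t : Finset (Finset B)} :
    t ∈ (davisFacet cs s).faces ↔ t ∈ (davisChamber cs).faces ∧ ∀ σ ∈ t, s ∉ σ := by
  constructor
  · rintro ⟨h1, h2⟩
    exact ⟨h1, fun σ hσ => (h2.2.1 σ hσ).2⟩
  · rintro ⟨h1, h2⟩
    exact ⟨h1, h1.1.1, fun σ hσ => ⟨h1.1.2.1 σ hσ, h2 σ hσ⟩, h1.1.2.2⟩

variable [Fintype B]

/-- The face carrying a point is determined by its support, so it is the same for every `s`. For
empty `J` the left side would be the whole ambient space. -/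
theorem iInter_geomRealization_davisFacet {J : Finset B} (hJ : J.Nonempty) :
    ⋂ s ∈ J, geomRealization (davisFacet cs s) = geomRealization (davisFacetInter cs J) := by
  ext x
  simp only [Set.mem_iInter]
  constructor
  · intro h
    obtain ⟨s₀, hs₀⟩ := hJ
    obtain ⟨hx, t, ht, hxt⟩ := h s₀ hs₀
    refine ⟨hx, t, ⟨((mem_davisFacet_faces cs).1 ht).1, fun σ hσ s hs => ?_⟩, hxt⟩
    obtain ⟨-, t', ht', hxt'⟩ := h s hs
    obtain rfl : t = t' := Finset.ext fun a => (hxt a).trans (hxt' a).symm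
    exact ((mem_davisFacet_faces cs).1 ht').2 σ hσ
  · rintro ⟨hx, t, ht, hxt⟩ s hs
    exact ⟨hx, t, (mem_davisFacet_faces cs).2 ⟨ht.1, fun σ hσ => ht.2 σ hσ s hs⟩, hxt⟩

/-- A common point yields a nonempty face `σ` disjoint from `J` with `W_σ` finite, and `W_J ≤ W_σ`.
-/
theorem finite_of_nonempty_iInter_davisFacet {J : Finset B} (hJ : J.Nonempty)
    (h : (⋂ s ∈ J, geomRealization (davisFacet cs s)).Nonempty) :
    Finite (parabolicSubgroup cs (J : Set B)) ∧ J ≠ Finset.univ := by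
  rw [iInter_geomRealization_davisFacet cs hJ] at h
  obtain ⟨x, -, t, ht, -⟩ := h
  obtain ⟨σ, hσ⟩ := ht.1.1.1
  have hne : σ.Nonempty := ht.1.1.2.1 σ hσ
  have hfin := ht.1.2 σ hσ
  rw [faceParabolic_eq cs hne] at hfin
  refine ⟨finite_parabolicSubgroup_of_subset cs (fun s hs => ht.2 σ hσ s hs) hfin, ?_⟩
  rintro rfl
  obtain ⟨s, hs⟩ := hne
  exact ht.2 σ hσ s (Finset.mem_univ s) hs

/-- The set `Jᶜ` is the largest face disjoint from `J`, and its parabolic subgroup is `W_J`. It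
contains every face occurring in the intersection, so adding it to a chain leaves a chain: its
barycenter is a cone point. -/
theorem contractibleSpace_iInter_davisFacet {J : Finset B} (hJ : J.Nonempty)
    (hfin : Finite (parabolicSubgroup cs (J : Set B))) (huniv : J ≠ Finset.univ) :
    ContractibleSpace (⋂ s ∈ J, geomRealization (davisFacet cs s) : Set (Finset B → ℝ)) := by
  classical
  rw [iInter_geomRealization_davisFacet cs hJ]
  have hne : (Jᶜ : Finset B).Nonempty :=
    Finset.nonempty_iff_ne_empty.2 fun h => huniv (by simpa using h)
  have hJfin : Finite (faceParabolic cs Jᶜ) := by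
    have hJ' : {s | s ∉ Jᶜ} = (J : Set B) := by
      ext s
      simp
    rwa [faceParabolic_eq cs hne, hJ']
  have hnot : ∀ s ∈ J, s ∉ Jᶜ := fun s hs h => Finset.mem_compl.1 h hs
  refine contractibleSpace_geomRealization_of_cone Jᶜ
    ⟨⟨⟨Finset.singleton_nonempty _, ?_, ?_⟩, ?_⟩, ?_⟩ fun t ht =>
    ⟨⟨⟨Finset.insert_nonempty _ _, ?_, ?_⟩, ?_⟩, ?_⟩
  · intro σ hσ
    rw [Finset.mem_singleton.1 hσ]
    exact hne
  · rw [Finset.coe_singleton]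
    exact Set.subsingleton_singleton.isChain
  · intro σ hσ
    rwa [Finset.mem_singleton.1 hσ]
  · intro σ hσ
    rwa [Finset.mem_singleton.1 hσ]
  · intro σ hσ
    rcases Finset.mem_insert.1 hσ with rfl | hσ
    · exact hne
    · exact ht.1.1.2.1 σ hσ
  · rw [Finset.coe_insert]
    refine ht.1.1.2.2.insert fun σ hσ _ => Or.inr fun s hs => Finset.mem_compl.2 fun h => ?_
    exact ht.2 σ hσ s h hs
  · intro σ hσ
    rcases Finset.mem_insert.1 hσ with rfl | hσ
    · exact hJfin
    · exact ht.1.2 σ hσ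
  · intro σ hσ
    rcases Finset.mem_insert.1 hσ with rfl | hσ
    · exact hnot
    · exact ht.2 σ hσ

theorem nonempty_iInter_davisFacet_iff {J : Finset B} (hJ : J.Nonempty) :
    (⋂ s ∈ J, geomRealization (davisFacet cs s)).Nonempty ↔
      Finite (parabolicSubgroup cs (J : Set B)) ∧ J ≠ Finset.univ := by
  refine ⟨finite_of_nonempty_iInter_davisFacet cs hJ, fun h => ?_⟩
  have := contractibleSpace_iInter_davisFacet cs hJ h.1 h.2
  exact Set.nonempty_coe_sort.1 PathConnectedSpace.nonempty

theorem ne_univ_of_finite_parabolicSubgroup [Infinite W] {J : Finset B}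
    (h : Finite (parabolicSubgroup cs (J : Set B))) : J ≠ Finset.univ := by
  rintro rfl
  rw [Finset.coe_univ, parabolicSubgroup_univ] at h
  have := (Subgroup.topEquiv (G := W)).toEquiv.symm.finite_iff.2 h
  exact not_finite W

theorem isMinimalInfinite_iff [Infinite W] (J : Finset B) :
    IsMinimalInfinite cs J ↔ IsMinimalEmptyIntersection cs J := by
  have key : ∀ {J : Finset B}, J.Nonempty →
      ((⋂ s ∈ J, geomRealization (davisFacet cs s)).Nonempty ↔
        Finite (parabolicSubgroup cs (J : Set B))) := fun hJ =>
    (nonempty_iInter_davisFacet_iff cs hJ).trans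
      ⟨And.left, fun h => ⟨h, ne_univ_of_finite_parabolicSubgroup cs h⟩⟩
  -- For `J = ∅` both conditions fail: the trivial group is finite, and the empty intersection is
  -- the ambient space.
  rcases J.eq_empty_or_nonempty with rfl | hJ
  · constructor
    · intro h
      exact absurd h.two_le_card (by simp)
    · intro h
      have := h.2
      simp at this
  rw [IsMinimalInfinite, IsMinimalEmptyIntersection, ← Set.not_nonempty_iff_eq_empty, key hJ,
    not_finite_iff_infinite]
  constructor
  · rintro ⟨h1, h2⟩
    exact ⟨fun J' hne hJ' => (key hne).2 (h2 J' hJ'), h1⟩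
  · rintro ⟨h1, h2⟩
    refine ⟨h2, fun J' hJ' => ?_⟩
    rcases J'.eq_empty_or_nonempty with rfl | hne
    · rw [Finset.coe_empty]
      exact finite_parabolicSubgroup_empty cs
    · exact (key hne).1 (h1 J' hne hJ')

/-- Proper intersections are nonempty by hypothesis, and for intersections of the `D_s` nonempty
already implies contractible. -/
theorem IsMinimalEmptyIntersection.hasCohomologyOfUnitSphere {cs : CoxeterSystem M W}
    {J : Finset B} (h : IsMinimalEmptyIntersection cs J) {n : ℕ} (hn : J.card = n + 1) :
    HasCohomologyOfUnitSphere (davisUnion cs J) n := by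
  classical
  have hunion : davisUnion cs J = geomRealization (⨆ s : J, davisFacet cs s) := by
    rw [geomRealization_iSup, davisUnion, Set.iUnion_subtype]
  rw [hunion]
  refine hasCohomologyOfUnitSphere_of_cover (by simpa using hn) (fun S hS hSu => ?_) ?_
  · have hS' : (S.map (Function.Embedding.subtype _)).Nonempty := hS.map
    have hss : S.map (Function.Embedding.subtype _) ⊂ J := by
      refine (Finset.ssubset_iff_subset_ne).2 ⟨fun s hs => ?_, fun heq => hSu ?_⟩
      · obtain ⟨s, -, rfl⟩ := Finset.mem_map.1 hs
        exact s.2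
      · refine Finset.eq_univ_iff_forall.2 fun s => ?_
        obtain ⟨s', hs', hss'⟩ := Finset.mem_map.1 (heq.symm.subset s.2)
        rwa [← Subtype.ext hss']
    have hfin := finite_of_nonempty_iInter_davisFacet cs hS' (h.1 _ hS' hss)
    have := contractibleSpace_iInter_davisFacet cs hS' hfin.1 hfin.2
    have heq : ⋂ s ∈ S.map (Function.Embedding.subtype _), geomRealization (davisFacet cs s) =
        ⋂ s ∈ S, geomRealization (davisFacet cs s.1) := by
      ext x
      simp
    rwa [heq] at this
  · rw [← h.2, Set.iInter_subtype]

theorem hasCohomologyOfUnitSphere_davisUnion {J : Finset B}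
    (h : IsMinimalInfinite cs J ∨ IsMinimalEmptyIntersection cs J) {n : ℕ} (hn : J.card = n + 1) :
    HasCohomologyOfUnitSphere (davisUnion cs J) n := by
  rcases h with h | h
  -- Condition (a) forces `W` to be infinite, so the equivalence with (b) applies.
  · have := infinite_of_infinite_parabolicSubgroup cs h.1
    exact ((isMinimalInfinite_iff cs J).1 h).hasCohomologyOfUnitSphere hn
  · exact h.hasCohomologyOfUnitSphere hn

end DavisChamber

theorem mainTheorem4 :
    -- finite covers by subcomplexes
    (∀ {V : Type u} [Fintype V] {I : Type w} [Fintype I]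
      (K : PreAbstractSimplicialComplex V) (X : I → PreAbstractSimplicialComplex V) (n : ℕ),
      Fintype.card I = n + 1 →
      K = ⨆ i, X i →
      (∀ I' : Finset I, I'.Nonempty → I' ≠ Finset.univ →
        ContractibleSpace (⋂ i ∈ I', geomRealization (X i) : Set (V → ℝ))) →
      ⋂ i, geomRealization (X i) = ∅ →
      HasCohomologyOfUnitSphere (geomRealization K) n) ∧
    -- subcomplexes of the Davis chamber
    (∀ {B : Type u} [Fintype B] {M : CoxeterMatrix B} {W : Type v} [Group W]
      (cs : CoxeterSystem M W) (J : Finset B),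
      (Infinite W → (IsMinimalInfinite cs J ↔ IsMinimalEmptyIntersection cs J)) ∧
      (∀ n : ℕ, J.card = n + 1 → IsMinimalInfinite cs J ∨ IsMinimalEmptyIntersection cs J →
        HasCohomologyOfUnitSphere (davisUnion cs J) n) ∧
      (IsMinimalInfinite cs J → 2 ≤ J.card)) := by
  refine ⟨?_, fun {B} _ {M W} _ cs J => ⟨fun hW => isMinimalInfinite_iff cs J, fun n hn h =>
    hasCohomologyOfUnitSphere_davisUnion cs h hn, fun h => h.two_le_card⟩⟩
  rintro V _ I _ K X n hI rfl hX hempty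
  exact hasCohomologyOfUnitSphere_of_cover hI hX hempty
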